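/- Let $q_+,q_->1$ be integers and let $T$ be a semi-homogeneous tree with vertex set $V$: a locally finite tree with an alternating parity $V=V_+\sqcup V_-$ such that every vertex of $V_\pm$ has exactly $q_\pm+1$ neighbours. Fix $v_0\in V_+$, and write $|v|=\mathrm{dist}(v,v_0)$ and $\mathfrak q=\sqrt{q_+q_-}$. A ray is an infinite sequence of consecutive neighbours without repetitions. The boundary $\Omega$ is the set of rays modulo the relation of coinciding after finitely many steps. It carries the topology generated by the arcs $\Omega(u,v)$, where $\Omega(u,v)$ is the set of boundary points represented by a ray that starts at $u$ and contains $v$ (so $\Omega(v,v)=\Omega$). For each vertex $u$ there is exactly one Borel probability measure $\nu_u$ on $\Omega$ (the equidistributed measure) such that $\nu_u(\Omega(u,w))=1/|\{x:\mathrm{dist}(x,u)=\mathrm{dist}(w,u)\}|$ for all $w\in V$. For $\omega\in\Omega$ the horospherical index is $h(v_1,v_2,\omega)=\mathrm{dist}(v_2,j)-\mathrm{dist}(v_1,j)$ for any vertex $j$ common to the rays $[v_1,\omega)$ and $[v_2,\omega)$ from $v_1$ and $v_2$ in the class $\omega$; such $j$ exist, and the value does not depend on the choice of $j$. Let $|v|=n$,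 let $[v_0,v_1,\dots,v_n=v]$ be the path from $v_0$ to $v$, and put $\Omega_0(v_0,v)=\Omega(v,v_0)$, $\Omega_k(v_0,v)=\Omega(v_0,v_k)\setminus\Omega(v_0,v_{k+1})$ for $0<k<n$, and $\Omega_n(v_0,v)=\Omega(v_0,v)$. Then $\nu_v\ll\nu_{v_0}$, and the Radon–Nikodym derivative $d\nu_v/d\nu_{v_0}$ has a unique continuous version, the Poisson kernel $\mathcal P(v,v_0,\cdot)$. For $0\le k\le n$ one has $\nu_{v_0}(\Omega_k(v_0,v))>0$, and for every $\omega\in\Omega_k(v_0,v)$ $$\mathcal P(v,v_0,\omega)=\frac{\nu_v(\Omega_k(v_0,v))}{\nu_{v_0}(\Omega_k(v_0,v))}=\begin{cases}(q_+q_-)^{k-\frac n2}&\text{if }n\text{ is even},\\[.2cm] \dfrac{q_++1}{q_-+1}\sqrt{\dfrac{q_-}{q_+}}\,(q_+q_-)^{k-\frac n2}&\text{if }n\text{ is odd},\end{cases}$$ and $h(v,v_0,\omega)=2k-n$. Consequently, for every $\omega\in\Omega$, $\mathcal P(v,v_0,\omega)=c_n\,\mathfrak q^{h(v,v_0,\omega)}$,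 where $c_n=1$ for $n$ even and $c_n=\frac{q_++1}{q_-+1}\sqrt{q_- /q_+}$ for $n$ odd. -/

import Mathlib

open MeasureTheory
open scoped ENNReal

namespace TreeBoundary

variable {V : Type*} (G : SimpleGraph V)

/-- A tree is semi-homogeneous with parity `ε` and homogeneity degrees `qp`, `qm`: the parity
alternates along edges, vertices of parity `1` have `qp + 1` neighbours, and vertices of
parity `-1` have `qm + 1` neighbours. -/
structure IsSemihomogeneousTree [G.LocallyFinite] (ε : V → ℤˣ) (qp qm : ℕ) : Prop where
  isTree : G.IsTree
  alternating : ∀ v w, G.Adj v w → ε w = -ε v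
  degree_pos : ∀ v, ε v = 1 → G.degree v = qp + 1
  degree_neg : ∀ v, ε v = -1 → G.degree v = qm + 1

/-- A ray: an infinite sequence of consecutive neighbours without repetitions. -/
structure Ray where
  vert : ℕ → V
  adj : ∀ i, G.Adj (vert i) (vert (i + 1))
  inj : Function.Injective vert

/-- Two rays are equivalent if they merge after finitely many steps and coincide thereafter. -/
instance raySetoid : Setoid (Ray G) where
  r f g := ∃ m n, ∀ i, f.vert (m + i) = g.vert (n + i)
  iseqv :=
    { refl := fun _ => ⟨0, 0, fun _ => rfl⟩
      symm := fun ⟨m, n, h⟩ => ⟨n, m, fun i => (h i).symm⟩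
      trans := by
        rintro f g k ⟨m, n, h⟩ ⟨a, b, h'⟩
        refine ⟨m + a, b + n, fun i => ?_⟩
        have h1 := h (a + i)
        have h2 := h' (n + i)
        rw [show n + (a + i) = a + (n + i) by omega] at h1
        rw [Nat.add_assoc, Nat.add_assoc, h1, h2] }

/-- The boundary of the tree: equivalence classes of rays. -/
def Boundary : Type _ := Quotient (raySetoid G)

/-- The boundary arc `Ω(u, v)`: the boundary points whose class includes a ray that starts at `u`
and contains `v`. -/
def arc (u v : V) : Set (Boundary G) :=
  {ω | ∃ f : Ray G, f.vert 0 = u ∧ v ∈ Set.range f.vert ∧ Quotient.mk (raySetoid G) f = ω}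

/-- The topology generated by the boundary arcs. -/
instance : TopologicalSpace (Boundary G) :=
  TopologicalSpace.generateFrom {S | ∃ u v, S = arc G u v}

instance : MeasurableSpace (Boundary G) := borel (Boundary G)

instance : BorelSpace (Boundary G) := ⟨rfl⟩

/-- `μ` is a Borel probability measure giving `Ω(u, w)` the mass `1 / |{x : dist(x, u) = n}|`
whenever `dist(w, u) = n`. -/
structure IsEquidistributed (u : V) (μ : Measure (Boundary G)) : Prop where
  prob : IsProbabilityMeasure μ
  arc_eq : ∀ w, μ (arc G u w) = 1 / (({x | G.dist x u = G.dist w u}.ncard : ℕ) : ℝ≥0∞)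

open Classical in
/-- The equidistributed boundary measure `ν_u` (the value `0` is taken only if no
equidistributed measure exists). -/
noncomputable def nu (u : V) : Measure (Boundary G) :=
  if h : ∃ μ, IsEquidistributed G u μ then h.choose else 0

/-- The Poisson kernel: the Radon-Nikodym derivative of `ν_v` with respect to `ν_{v₀}`. -/
noncomputable def poissonKernel (v v₀ : V) (ω : Boundary G) : ℝ :=
  ((nu G v).rnDeriv (nu G v₀) ω).toReal

/-- The vertices of `[v, ω)`, the ray from `v` in the class `ω`. -/
def rayTo (v : V) (ω : Boundary G) : Set V := {j | ω ∈ arc G v j}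

/-- The horospherical index `h(v₁, v₂, ω) = dist(v₂, j) - dist(v₁, j)`, where `j` is any
vertex of `[v₁, ω) ∩ [v₂, ω)`. -/
noncomputable def horoIndex (v₁ v₂ : V) (ω : Boundary G) : ℤ :=
  let j := @Classical.epsilon V ⟨v₁⟩ (fun j => j ∈ rayTo G v₁ ω ∩ rayTo G v₂ ω)
  (G.dist v₂ j : ℤ) - (G.dist v₁ j : ℤ)

/-- The arc `Ω_k(u, v)` of the boundary points whose closest vertex in the chain
`p = [v_0, …, v_n]` from `u = v_0` to `v = v_n` is `v_k`; meaningful for `k ≤ n`. -/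
def arcAt {u v : V} (p : G.Walk u v) (k : ℕ) : Set (Boundary G) :=
  if k = 0 then arc G v u
  else if k < p.length then arc G u (p.getVert k) \ arc G u (p.getVert (k + 1))
  else arc G u v

/-- The factor depending only on the parity of `n`. -/
noncomputable def parityFactor (qp qm n : ℕ) : ℝ :=
  if Even n then 1 else ((qp : ℝ) + 1) / ((qm : ℝ) + 1) * √((qm : ℝ) / (qp : ℝ))

end TreeBoundary

/-!
The argument runs through the Busemann function `busemann ω` of a boundary point `ω`, the limit of
`dist(·, f i) - i` along a ray `f` in the class `ω`. Both it and the distance from a fixed vertex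
change by one along every edge and decrease along at most one edge at each vertex
(`IsPotential`). Hence such a function, once it increases along a geodesic, keeps increasing
(`IsPotential.eq_add_dist_of_last`), and all incidence questions become arithmetic:
`ω ∈ Ω(u, w)` if and only if `busemann ω u - busemann ω w = dist u w` (`mem_arc_iff`), and
`h(x, y, ω) = busemann ω y - busemann ω x` (`horoIndex_eq`). In particular the horospherical index
is locally constant in `ω`, it equals `2k - n` on `Ω_k`, the arcs are clopen, and the arcs
`Ω(u, w)` with `dist u w > n` form a basis of the topology and a π-system that generates the Borel
sets.

The measure `ν_u` is the law of the end of a random ray from `u` that moves from each vertex `x`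
to a uniformly chosen child, all choices being independent. The event that the ray visits `w` is
a box in the product of the sets of children, and its probability is the product of the
reciprocals of the numbers of children along the geodesic from `u` to `w`, which is the reciprocal
of the size of the sphere (`exists_box`).

Write `q_x` for the homogeneity degree of `x` and `𝔮 = √(q_+ q_-)`. The size of the sphere about
`u` through `w ≠ u` is
`(q_u + 1) 𝔮 ^ dist(u, w) / √(q_u q_w)` (`ncard_sphere_mul_sqrt`). If `dist(u, w) > dist(u, v)`,
then `Ω(u, w) = Ω(v, w)`, the index `h(v, u, ·)` has the constant value `dist(u, w) - dist(v, w)`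
on this arc, and its masses for `ν_v` and `ν_u` have the ratio `c 𝔮 ^ h(v, u, ·)`, where `c` depends
on `u` and `v` only. As these arcs determine a measure, `ν_v` has the continuous density
`c 𝔮 ^ h(v, u, ·)` with respect to `ν_u` (`nu_eq_withDensity`). The ratios of the masses of the
sets `Ω_k` follow, because the density is constant on them, and the continuous version is unique
because `ν_u` charges every nonempty open set.
-/

namespace TreeBoundary

open Filter

variable {V : Type*} {G : SimpleGraph V}

/-! ### Potentials on a tree -/

/-- An integer-valued function on the vertices which changes by one along every edge and
decreases along at most one edge at each vertex. On a tree, the distance from a fixed vertex and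
the Busemann function of a boundary point have this property. -/
structure IsPotential (G : SimpleGraph V) (φ : V → ℤ) : Prop where
  step : ∀ ⦃x y⦄, G.Adj x y → φ x = φ y + 1 ∨ φ y = φ x + 1
  eq_of_lower : ∀ ⦃x y z⦄, G.Adj x y → G.Adj x z → φ x = φ y + 1 → φ x = φ z + 1 → y = z

theorem exists_adj_dist_eq_add_one (hG : G.Connected) {a x : V} {k : ℕ}
    (h : G.dist a x = k + 1) : ∃ y, G.Adj y x ∧ G.dist a y = k := by
  obtain ⟨p, hp⟩ := hG.exists_walk_length_eq_dist x a
  rw [SimpleGraph.dist_comm, h] at hp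
  cases p with
  | nil => simp at hp
  | @cons _ y _ hadj q =>
    refine ⟨y, hadj.symm, ?_⟩
    have h1 := SimpleGraph.dist_le q
    have h2 := hG.dist_triangle (u := a) (v := y) (w := x)
    have h3 := SimpleGraph.dist_eq_one_iff_adj.2 hadj.symm
    simp only [SimpleGraph.Walk.length_cons] at hp
    rw [SimpleGraph.dist_comm] at h1
    omega

namespace IsPotential

variable {φ : V → ℤ}

theorem le_add_dist (hφ : IsPotential G φ) (hG : G.Connected) (a b : V) :
    φ a ≤ φ b + G.dist a b := by
  induction hk : G.dist a b generalizing b with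
  | zero =>
    obtain rfl := hG.dist_eq_zero_iff.1 hk
    simp
  | succ k ih =>
    obtain ⟨y, hy, hd⟩ := exists_adj_dist_eq_add_one hG hk
    have := ih y hd
    have := hφ.step hy
    push_cast
    omega

/-- If a potential decreases along the last edge of a geodesic, then it decreases along every
edge of that geodesic: having increased once, it would go on increasing. -/
theorem eq_add_dist_of_last (hφ : IsPotential G φ) (hG : G.Connected) {a y z : V}
    (hyz : G.Adj y z) (hd : G.dist a z = G.dist a y + 1) (h : φ y = φ z + 1) :
    φ a = φ z + G.dist a z := by
  induction hk : G.dist a y generalizing y z with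
  | zero =>
    obtain rfl := hG.dist_eq_zero_iff.1 hk
    rw [hd, hk]
    simpa using h
  | succ k ih =>
    obtain ⟨x, hx, hxd⟩ := exists_adj_dist_eq_add_one hG hk
    have hxy : φ x = φ y + 1 := by
      rcases hφ.step hx with h' | h'
      · exact h'
      · obtain rfl := hφ.eq_of_lower hx.symm hyz h' h
        omega
    have := ih hx (by omega) hxy hxd
    push_cast [hd, hk] at this ⊢
    omega

theorem eq_add_dist_of_adj (hφ : IsPotential G φ) (hG : G.Connected) {a y z : V}
    (hyz : G.Adj y z) (hd : G.dist a z = G.dist a y + 1) (h : φ a = φ z + G.dist a z) :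
    φ a = φ y + G.dist a y ∧ φ y = φ z + 1 := by
  have h1 := hφ.le_add_dist hG a y
  rcases hφ.step hyz with h2 | h2 <;> push_cast [hd] at h <;> omega

theorem eq_of_eq_add_dist (hφ : IsPotential G φ) (hG : G.Connected) {a x y : V}
    (hx : φ a = φ x + G.dist a x) (hy : φ a = φ y + G.dist a y)
    (hxy : G.dist a x = G.dist a y) : x = y := by
  induction hk : G.dist a x generalizing x y with
  | zero =>
    rw [← hG.dist_eq_zero_iff.1 hk, ← hG.dist_eq_zero_iff.1 (hxy.symm.trans hk)]
  | succ k ih =>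
    obtain ⟨x', hx', hdx⟩ := exists_adj_dist_eq_add_one hG hk
    obtain ⟨y', hy', hdy⟩ := exists_adj_dist_eq_add_one hG (hxy.symm.trans hk)
    have ex := hφ.eq_add_dist_of_adj hG hx' (by omega) hx
    have ey := hφ.eq_add_dist_of_adj hG hy' (by omega) hy
    obtain rfl := ih ex.1 ey.1 (by omega) hdx
    exact hφ.eq_of_lower hx' hy' ex.2 ey.2

theorem eq_add_dist_trans (hφ : IsPotential G φ) (hG : G.Connected) {a b w : V}
    (hd : G.dist a w = G.dist a b + G.dist b w) (h : φ a = φ w + G.dist a w) :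
    φ a = φ b + G.dist a b := by
  have h1 := hφ.le_add_dist hG a b
  have h2 := hφ.le_add_dist hG b w
  push_cast [hd] at h
  omega

end IsPotential

theorem isPotential_dist (hG : G.IsTree) (u : V) : IsPotential G (fun x => (G.dist u x : ℤ)) where
  step x y h := by
    have := hG.dist_eq_dist_add_one_of_adj u h
    omega
  eq_of_lower x y z hy hz h1 h2 := by
    have key : ∀ y, G.Adj x y → (G.dist u x : ℤ) = G.dist u y + 1 →
        ∃ p : G.Walk x u, p.IsPath ∧ p.snd = y := by
      intro y hy h
      obtain ⟨p, hp⟩ := hG.connected.exists_walk_length_eq_dist y u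
      refine ⟨.cons hy p, SimpleGraph.Walk.isPath_of_length_eq_dist _ ?_, by simp⟩
      rw [SimpleGraph.Walk.length_cons, hp, SimpleGraph.dist_comm, G.dist_comm (u := x)]
      omega
    obtain ⟨p, hp, rfl⟩ := key y hy h1
    obtain ⟨q, hq, rfl⟩ := key z hz h2
    rw [(hG.existsUnique_path x u).unique hp hq]

/-! ### Busemann functions -/

/-- The boundary point represented by a ray. -/
def Ray.limit (f : Ray G) : Boundary G := Quotient.mk (raySetoid G) f

theorem exists_limit_eq (ω : Boundary G) : ∃ f : Ray G, f.limit = ω :=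
  Quotient.exists_rep ω

theorem Ray.limit_mem_arc (f : Ray G) (i : ℕ) : f.limit ∈ arc G (f.vert 0) (f.vert i) :=
  ⟨f, rfl, ⟨i, rfl⟩, rfl⟩

/-- A ray that has moved away from `x` once keeps moving away from `x`: a step back would lead to
the unique neighbour closer to `x`, which the ray has just left. -/
theorem Ray.dist_step (hG : G.IsTree) (f : Ray G) (x : V) (i : ℕ)
    (h : G.dist x (f.vert (i + 1)) = G.dist x (f.vert i) + 1) (j : ℕ) :
    G.dist x (f.vert (i + j)) = G.dist x (f.vert i) + j := by
  have hφ := isPotential_dist hG x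
  have key : ∀ j, G.dist x (f.vert (i + j + 1)) = G.dist x (f.vert (i + j)) + 1 := by
    intro j
    induction j with
    | zero => exact h
    | succ j ih =>
      rcases hφ.step (f.adj (i + (j + 1))) with h' | h'
      · have := hφ.eq_of_lower (f.adj (i + j)).symm (f.adj (i + j + 1)) (by simp [ih])
          (by simpa [add_assoc] using h')
        have := f.inj this
        omega
      · exact_mod_cast h'
  induction j with
  | zero => simp
  | succ j ih => rw [← add_assoc, key, ih, add_assoc]

theorem Ray.dist_zero (hG : G.IsTree) (f : Ray G) (i : ℕ) :
    G.dist (f.vert 0) (f.vert i) = i := by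
  simpa using f.dist_step hG (f.vert 0) 0 (by simpa using f.adj 0) i

theorem Ray.exists_dist_eq (hG : G.IsTree) (f : Ray G) (x : V) :
    ∃ c : ℤ, ∀ᶠ i in atTop, (G.dist x (f.vert i) : ℤ) = i + c := by
  -- The distance from `x` cannot decrease forever.
  obtain ⟨N, hN⟩ : ∃ N, G.dist x (f.vert (N + 1)) = G.dist x (f.vert N) + 1 := by
    by_contra! hcon
    have key : ∀ i, G.dist x (f.vert i) + i = G.dist x (f.vert 0) := by
      intro i
      induction i with
      | zero => simp
      | succ i ih =>
        have := (isPotential_dist hG x).step (f.adj i)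
        have := hcon i
        omega
    have := key (G.dist x (f.vert 0) + 1)
    omega
  refine ⟨G.dist x (f.vert N) - N, eventually_atTop.2 ⟨N, fun i hi => ?_⟩⟩
  obtain ⟨j, rfl⟩ := Nat.exists_eq_add_of_le hi
  rw [f.dist_step hG x N hN j]
  push_cast
  ring

/-- The Busemann function of a boundary point `ω`: the limit of `dist(x, f i) - i`, where `f` is a
chosen ray in the class `ω`. Another choice of `f` changes it by an additive constant. -/
noncomputable def busemann (ω : Boundary G) (x : V) : ℤ :=
  Classical.epsilon fun c : ℤ =>
    ∀ᶠ i in atTop, (G.dist x ((Quotient.out ω : Ray G).vert i) : ℤ) = i + c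

/-- Along any ray `g` in the class `ω`, the distance from `x` is eventually `i + busemann ω x` up to
a constant which does not depend on `x`. -/
theorem busemann_spec (hG : G.IsTree) (g : Ray G) :
    ∃ c : ℤ, ∀ x, ∀ᶠ i in atTop,
      (G.dist x (g.vert i) : ℤ) = i + busemann g.limit x + c := by
  set ω : Boundary G := g.limit with hω
  obtain ⟨m, n, h⟩ : raySetoid G (Quotient.out ω) g := Quotient.exact (Quotient.out_eq ω)
  refine ⟨m - n, fun x => ?_⟩
  have h1 : ∀ᶠ i in atTop, (G.dist x ((Quotient.out ω : Ray G).vert i) : ℤ) =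
      i + busemann ω x := Classical.epsilon_spec ((Quotient.out ω : Ray G).exists_dist_eq hG x)
  obtain ⟨N, hN⟩ := eventually_atTop.1 h1
  refine eventually_atTop.2 ⟨N + n, fun i hi => ?_⟩
  obtain ⟨j, rfl⟩ := Nat.exists_eq_add_of_le (show n ≤ i by omega)
  have := hN (m + j) (by omega)
  rw [h j] at this
  push_cast at this ⊢
  omega

theorem eventually_busemann (hG : G.IsTree) (g : Ray G) (x y : V) :
    ∀ᶠ i in atTop, (G.dist x (g.vert i) : ℤ) - G.dist y (g.vert i) =
      busemann g.limit x - busemann g.limit y := by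
  obtain ⟨c, hc⟩ := busemann_spec hG g
  filter_upwards [hc x, hc y] with i h1 h2
  omega

theorem isPotential_busemann (hG : G.IsTree) (ω : Boundary G) : IsPotential G (busemann ω) := by
  obtain ⟨f, rfl⟩ := exists_limit_eq ω
  constructor
  · intro x y h
    obtain ⟨i, hi⟩ := (eventually_busemann hG f x y).exists
    have := hG.dist_eq_dist_add_one_of_adj (f.vert i) h
    rw [G.dist_comm (v := x), G.dist_comm (v := y)] at this
    omega
  · intro x y z hy hz h1 h2
    obtain ⟨i, h3, h4⟩ := ((eventually_busemann hG f x y).and (eventually_busemann hG f x z)).exists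
    rw [G.dist_comm, G.dist_comm (u := y)] at h3
    rw [G.dist_comm, G.dist_comm (u := z)] at h4
    exact (isPotential_dist hG (f.vert i)).eq_of_lower hy hz (by omega) (by omega)

theorem Ray.busemann_vert (hG : G.IsTree) (g : Ray G) (i : ℕ) :
    busemann g.limit (g.vert 0) =
      busemann g.limit (g.vert i) + i := by
  obtain ⟨j, h1, h2⟩ :=
    ((eventually_busemann hG g (g.vert 0) (g.vert i)).and (eventually_ge_atTop i)).exists
  obtain ⟨k, rfl⟩ := Nat.exists_eq_add_of_le h2
  have h3 : G.dist (g.vert i) (g.vert (i + k)) = k := by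
    simpa using Ray.dist_zero hG ⟨fun k => g.vert (i + k), fun k => g.adj _,
      fun a b h => by simpa using g.inj h⟩ k
  rw [h3, g.dist_zero hG] at h1
  push_cast at h1
  omega

theorem eventually_busemann_eq_add_dist (hG : G.IsTree) (g : Ray G) (x : V) :
    ∀ᶠ i in atTop, busemann g.limit x =
      busemann g.limit (g.vert i) + G.dist x (g.vert i) := by
  filter_upwards [eventually_busemann hG g x (g.vert 0)] with i hi
  have := g.busemann_vert hG i
  rw [g.dist_zero hG] at hi
  omega

theorem exists_adj_busemann_lower (hG : G.IsTree) (ω : Boundary G) (x : V) :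
    ∃ y, G.Adj x y ∧ busemann ω x = busemann ω y + 1 := by
  obtain ⟨f, rfl⟩ := exists_limit_eq ω
  have hφ := isPotential_busemann hG f.limit
  obtain ⟨c, hc⟩ := busemann_spec hG f
  obtain ⟨i, hi, h2, h3⟩ := ((eventually_busemann_eq_add_dist hG f x).and
    ((hc x).and (eventually_gt_atTop
      (busemann f.limit x + c).natAbs))).exists
  obtain ⟨k, hk⟩ : ∃ k, G.dist (f.vert i) x = k + 1 :=
    Nat.exists_eq_add_one.2 (by rw [G.dist_comm]; omega)
  obtain ⟨y, hy, hyk⟩ := exists_adj_dist_eq_add_one hG.connected hk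
  refine ⟨y, hy.symm, ?_⟩
  have h1 := hφ.le_add_dist hG.connected y (f.vert i)
  have h4 := hφ.step hy
  rw [G.dist_comm] at hk hyk
  omega

/-- Following the edges along which the Busemann function of `ω` decreases gives a ray from `a`
in the class `ω`, and it passes through every `b` for which the Busemann function decreases along
the geodesic from `a` to `b`. -/
theorem mem_arc_iff (hG : G.IsTree) {a b : V} {ω : Boundary G} :
    ω ∈ arc G a b ↔ busemann ω a = busemann ω b + G.dist a b := by
  constructor
  · rintro ⟨f, rfl, ⟨i, rfl⟩, rfl⟩
    rw [f.dist_zero hG]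
    exact f.busemann_vert hG i
  · intro hab
    have hφ := isPotential_busemann hG ω
    choose par hadj hlow using exists_adj_busemann_lower hG ω
    let g : ℕ → V := fun i => par^[i] a
    have gs : ∀ i, g (i + 1) = par (g i) := fun i => Function.iterate_succ_apply' _ _ _
    have hg : ∀ i, busemann ω a = busemann ω (g i) + i := by
      intro i
      induction i with
      | zero => simp [g]
      | succ i ih =>
        have := hlow (g i)
        rw [← gs] at this
        push_cast
        omega
    have hle : ∀ i, G.dist a (g i) ≤ i := by
      intro i
      induction i with
      | zero => simp [g]
      | succ i ih =>
        have h1 := hG.connected.dist_triangle (u := a) (v := g i) (w := g (i + 1))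
        have h2 := SimpleGraph.dist_eq_one_iff_adj.2 (hadj (g i))
        rw [← gs] at h2
        omega
    have hdist : ∀ i, G.dist a (g i) = i := by
      intro i
      have h1 := hφ.le_add_dist hG.connected a (g i)
      have h2 := hg i
      have h3 := hle i
      omega
    have huniq : ∀ x, busemann ω a = busemann ω x + G.dist a x → g (G.dist a x) = x := by
      intro x hx
      refine hφ.eq_of_eq_add_dist hG.connected (a := a) ?_ hx (hdist _)
      rw [hdist]
      exact hg _
    refine ⟨⟨g, fun i => by rw [gs]; exact hadj _, fun i j h => ?_⟩, rfl, ⟨_, huniq b hab⟩, ?_⟩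
    · rw [← hdist i, ← hdist j, h]
    · obtain ⟨f, rfl⟩ := exists_limit_eq ω
      obtain ⟨c, hc⟩ := busemann_spec hG f
      obtain ⟨N, hN⟩ := eventually_atTop.1 ((eventually_busemann_eq_add_dist hG f a).and (hc a))
      refine Quotient.sound ⟨G.dist a (f.vert N), N, fun i => ?_⟩
      obtain ⟨h1, h2⟩ := hN N le_rfl
      obtain ⟨h3, h4⟩ := hN (N + i) (by omega)
      have h5 : G.dist a (f.vert N) + i = G.dist a (f.vert (N + i)) := by
        push_cast at h4
        omega
      change g _ = _
      rw [h5]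
      exact huniq _ h3

theorem eventually_mem_arc (hG : G.IsTree) (g : Ray G) (x : V) :
    ∀ᶠ i in atTop, g.limit ∈ arc G x (g.vert i) := by
  filter_upwards [eventually_busemann_eq_add_dist hG g x] with i hi
  exact (mem_arc_iff hG).2 hi

theorem exists_mem_arc_inter (hG : G.IsTree) (x y : V) (ω : Boundary G) :
    ∃ j, ω ∈ arc G x j ∧ ω ∈ arc G y j := by
  obtain ⟨f, rfl⟩ := exists_limit_eq ω
  obtain ⟨i, hi⟩ := ((eventually_mem_arc hG f x).and (eventually_mem_arc hG f y)).exists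
  exact ⟨_, hi⟩

theorem horoIndex_eq (hG : G.IsTree) (x y : V) (ω : Boundary G) :
    horoIndex G x y ω = busemann ω y - busemann ω x := by
  have h : ∃ j, j ∈ rayTo G x ω ∩ rayTo G y ω := exists_mem_arc_inter hG x y ω
  obtain ⟨h1, h2⟩ := Classical.epsilon_spec
    (p := fun j => j ∈ rayTo G x ω ∩ rayTo G y ω) h
  have h1 := (mem_arc_iff hG).1 h1
  have h2 := (mem_arc_iff hG).1 h2
  simp only [horoIndex]
  omega

/-- If `y` is the last vertex before `w` on the geodesic from `a` to `w`, then the arc `Ω(a, w)`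
depends on the oriented edge from `y` to `w` only. -/
theorem arc_eq_of_adj (hG : G.IsTree) {a y w : V} (h : G.Adj y w)
    (hd : G.dist a w = G.dist a y + 1) : arc G a w = arc G y w := by
  ext ω
  have hφ := isPotential_busemann hG ω
  rw [mem_arc_iff hG, mem_arc_iff hG, SimpleGraph.dist_eq_one_iff_adj.2 h]
  exact ⟨fun h' => (hφ.eq_add_dist_of_adj hG.connected h hd h').2,
    fun h' => hφ.eq_add_dist_of_last hG.connected h hd h'⟩

theorem arc_subset_arc (hG : G.IsTree) {a b w : V} (hd : G.dist a w = G.dist a b + G.dist b w) :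
    arc G a w ⊆ arc G a b := by
  intro ω hω
  rw [mem_arc_iff hG] at hω ⊢
  exact (isPotential_busemann hG ω).eq_add_dist_trans hG.connected hd hω

/-- Beyond the distance of `u` and `v`, the arcs seen from `u` and from `v` agree. -/
theorem arc_eq_arc_of_dist_lt (hG : G.IsTree) {u v w : V} (h : G.dist u v < G.dist u w) :
    arc G u w = arc G v w := by
  obtain ⟨k, hk⟩ := Nat.exists_eq_add_one.2 (show 0 < G.dist u w by omega)
  obtain ⟨y, hy, hyk⟩ := exists_adj_dist_eq_add_one hG.connected hk
  rw [arc_eq_of_adj hG hy (by omega)]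
  rcases hG.dist_eq_dist_add_one_of_adj v hy with h' | h'
  · have := (isPotential_dist hG v).eq_add_dist_of_last hG.connected (a := u) hy (by omega)
      (by exact_mod_cast h')
    rw [G.dist_comm (u := v) (v := u)] at this
    omega
  · exact (arc_eq_of_adj hG hy h').symm

/-- Arcs seen from one vertex are nested or disjoint. -/
theorem arc_subset_arc_of_mem (hG : G.IsTree) {u w₁ w₂ : V} {ω : Boundary G}
    (h₁ : ω ∈ arc G u w₁) (h₂ : ω ∈ arc G u w₂) (h : G.dist u w₁ ≤ G.dist u w₂) :
    arc G u w₂ ⊆ arc G u w₁ := by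
  rw [mem_arc_iff hG] at h₁
  obtain ⟨k, hk⟩ := Nat.exists_eq_add_of_le h
  clear h
  induction k generalizing w₂ with
  | zero =>
    rw [mem_arc_iff hG] at h₂
    rw [(isPotential_busemann hG ω).eq_of_eq_add_dist hG.connected h₁ h₂ hk.symm]
  | succ k ih =>
    rw [← add_assoc] at hk
    obtain ⟨y, hy, hyk⟩ := exists_adj_dist_eq_add_one hG.connected hk
    have hsub : arc G u w₂ ⊆ arc G u y := arc_subset_arc hG (by
      rw [SimpleGraph.dist_eq_one_iff_adj.2 hy]; omega)
    exact hsub.trans (ih (hsub h₂) hyk)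

/-! ### The topology of the boundary -/

theorem isOpen_arc (u v : V) : IsOpen (arc G u v) :=
  TopologicalSpace.isOpen_generateFrom_of_mem ⟨u, v, rfl⟩

theorem isLocallyConstant_busemann_sub (hG : G.IsTree) (x y : V) :
    IsLocallyConstant fun ω : Boundary G => busemann ω y - busemann ω x := by
  refine (IsLocallyConstant.iff_exists_open _).2 fun ω => ?_
  obtain ⟨j, h1, h2⟩ := exists_mem_arc_inter hG x y ω
  refine ⟨_, (isOpen_arc x j).inter (isOpen_arc y j), ⟨h1, h2⟩, fun ω' h' => ?_⟩
  rw [Set.mem_inter_iff, mem_arc_iff hG, mem_arc_iff hG] at h'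
  rw [mem_arc_iff hG] at h1 h2
  omega

theorem isClopen_arc (hG : G.IsTree) (u v : V) : IsClopen (arc G u v) := by
  convert (isLocallyConstant_busemann_sub hG v u).isClopen_fiber (G.dist u v : ℤ) using 1
  ext ω
  rw [mem_arc_iff hG, Set.mem_ofPred_eq]
  omega

/-- The arcs `Ω(u, f i)` along a ray `f` form a neighbourhood basis of its end. -/
theorem Ray.eventually_arc_subset (hG : G.IsTree) (u : V) (f : Ray G) {U : Set (Boundary G)}
    (hU : IsOpen U) (hf : f.limit ∈ U) :
    ∀ᶠ i in atTop, arc G u (f.vert i) ⊆ U := by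
  induction hU with
  | basic s hs =>
    obtain ⟨a, b, rfl⟩ := hs
    rw [mem_arc_iff hG] at hf
    obtain ⟨c, hc⟩ := busemann_spec hG f
    have hi := ((eventually_busemann hG f a b).and ((hc u).and ((hc a).and
      (eventually_gt_atTop (G.dist u a +
        (busemann f.limit u + c).natAbs)))))
    filter_upwards [hi] with i ⟨h1, h2, h3, h4⟩
    rw [arc_eq_arc_of_dist_lt hG (v := a) (by omega)]
    exact arc_subset_arc hG (by omega)
  | univ => exact .of_forall fun _ => Set.subset_univ _
  | inter s t _ _ hs ht =>
    filter_upwards [hs hf.1, ht hf.2] with i h1 h2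
    exact Set.subset_inter h1 h2
  | sUnion S _ ih =>
    obtain ⟨s, hs, hfs⟩ := hf
    filter_upwards [ih s hs hfs] with i hi
    exact hi.trans (Set.subset_sUnion_of_mem hs)

theorem isTopologicalBasis_arc (hG : G.IsTree) (u : V) (n : ℕ) :
    TopologicalSpace.IsTopologicalBasis {S | ∃ w, n < G.dist u w ∧ S = arc G u w} := by
  refine TopologicalSpace.isTopologicalBasis_of_isOpen_of_nhds ?_ fun ω U hω hU => ?_
  · rintro _ ⟨w, _, rfl⟩
    exact isOpen_arc u w
  · obtain ⟨f, rfl⟩ := exists_limit_eq ω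
    obtain ⟨c, hc⟩ := busemann_spec hG f
    obtain ⟨i, h1, h2, h3, h4⟩ := ((f.eventually_arc_subset hG u hU hω).and
      ((eventually_mem_arc hG f u).and ((hc u).and (eventually_gt_atTop
        (n + (busemann f.limit u + c).natAbs))))).exists
    exact ⟨_, ⟨f.vert i, by omega, rfl⟩, h2, h1⟩

theorem isPiSystem_arc (hG : G.IsTree) (u : V) (n : ℕ) :
    IsPiSystem {S | ∃ w, n < G.dist u w ∧ S = arc G u w} := by
  rintro _ ⟨w₁, h₁, rfl⟩ _ ⟨w₂, h₂, rfl⟩ ⟨ω, hω₁, hω₂⟩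
  rcases le_total (G.dist u w₁) (G.dist u w₂) with h | h
  · exact ⟨w₂, h₂, Set.inter_eq_right.2 (arc_subset_arc_of_mem hG hω₁ hω₂ h)⟩
  · exact ⟨w₁, h₁, Set.inter_eq_left.2 (arc_subset_arc_of_mem hG hω₂ hω₁ h)⟩

/-! ### Spheres -/

/-- The neighbours of `w` that are farther from `u` than `w` is. -/
def children (G : SimpleGraph V) (u w : V) : Set V :=
  {x | G.Adj w x ∧ G.dist u x = G.dist u w + 1}

/-- The sphere of radius `k` about `u`. -/
def sphere (G : SimpleGraph V) (u : V) (k : ℕ) : Set V := {x | G.dist x u = k}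

open Classical in
/-- The homogeneity degree `q_±` of a vertex of `V_±`; the vertex has one more neighbour. -/
noncomputable def homDegree (ε : V → ℤˣ) (qp qm : ℕ) (v : V) : ℕ := if ε v = 1 then qp else qm

theorem mem_sphere {u x : V} {k : ℕ} : x ∈ sphere G u k ↔ G.dist u x = k := by
  rw [G.dist_comm]
  rfl

theorem sphere_zero (hG : G.Connected) (u : V) : sphere G u 0 = {u} := by
  ext x
  rw [mem_sphere, hG.dist_eq_zero_iff, Set.mem_singleton_iff, eq_comm]

theorem sphere_succ (hG : G.Connected) (u : V) (k : ℕ) :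
    sphere G u (k + 1) = ⋃ x ∈ sphere G u k, children G u x := by
  ext x
  simp only [Set.mem_iUnion, mem_sphere, children, Set.mem_ofPred_eq, exists_prop]
  constructor
  · intro h
    obtain ⟨y, hy, hk⟩ := exists_adj_dist_eq_add_one hG h
    exact ⟨y, hk, hy, by omega⟩
  · rintro ⟨y, hy, -, h⟩
    omega

theorem children_finite [G.LocallyFinite] (u w : V) : (children G u w).Finite :=
  (Set.toFinite (G.neighborSet w)).subset fun _ h => h.1

theorem sphere_finite [G.LocallyFinite] (hG : G.Connected) (u : V) (k : ℕ) :
    (sphere G u k).Finite := by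
  induction k with
  | zero => rw [sphere_zero hG]; exact Set.finite_singleton u
  | succ k ih => rw [sphere_succ hG]; exact ih.biUnion fun x _ => children_finite u x

theorem sphere_ncard_pos [G.LocallyFinite] (hG : G.Connected) (u w : V) :
    0 < (sphere G u (G.dist u w)).ncard :=
  (Set.ncard_pos (sphere_finite hG u _)).2 ⟨w, mem_sphere.2 rfl⟩

theorem countable_of_connected [G.LocallyFinite] (hG : G.Connected) : Countable V := by
  obtain ⟨u⟩ := hG.nonempty
  have : (⋃ k, sphere G u k) = Set.univ :=
    Set.eq_univ_of_forall fun x => Set.mem_iUnion.2 ⟨_, mem_sphere.2 rfl⟩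
  rw [← Set.countable_univ_iff, ← this]
  exact Set.countable_iUnion fun k => (sphere_finite hG u k).countable

namespace IsSemihomogeneousTree

variable [G.LocallyFinite] {ε : V → ℤˣ} {qp qm : ℕ}

theorem parity_eq (hT : IsSemihomogeneousTree G ε qp qm) (u w : V) :
    ε w = ε u * (-1) ^ G.dist u w := by
  induction hk : G.dist u w generalizing w with
  | zero => simp [hT.isTree.connected.dist_eq_zero_iff.1 hk]
  | succ k ih =>
    obtain ⟨y, hy, hyk⟩ := exists_adj_dist_eq_add_one hT.isTree.connected hk
    rw [hT.alternating y w hy, ih y hyk, pow_succ, mul_neg, mul_one, mul_neg]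

theorem degree_eq (hT : IsSemihomogeneousTree G ε qp qm) (v : V) :
    G.degree v = homDegree ε qp qm v + 1 := by
  unfold homDegree
  split_ifs with h
  · exact hT.degree_pos v h
  · exact hT.degree_neg v ((Int.units_eq_one_or _).resolve_left h)

theorem homDegree_mul_of_adj (hT : IsSemihomogeneousTree G ε qp qm) {x y : V} (h : G.Adj x y) :
    homDegree ε qp qm x * homDegree ε qp qm y = qp * qm := by
  have := hT.alternating x y h
  unfold homDegree
  rcases Int.units_eq_one_or (ε x) with h' | h' <;> simp [this, h', mul_comm]

theorem ncard_children (hT : IsSemihomogeneousTree G ε qp qm) (u w : V) [Decidable (u = w)] :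
    (children G u w).ncard =
      if u = w then homDegree ε qp qm w + 1 else homDegree ε qp qm w := by
  have hdeg : (G.neighborSet w).ncard = homDegree ε qp qm w + 1 := by
    rw [← hT.degree_eq, ← SimpleGraph.card_neighborSet_eq_degree, ← Nat.card_coe_set_eq,
      Nat.card_eq_fintype_card]
  have hG := hT.isTree
  split_ifs with h
  · subst h
    rw [← hdeg]
    congr 1
    ext x
    simp only [children, Set.mem_ofPred_eq, SimpleGraph.mem_neighborSet, SimpleGraph.dist_self,
      zero_add, SimpleGraph.dist_eq_one_iff_adj, and_self]
  · obtain ⟨k, hk⟩ := Nat.exists_eq_add_one.2 (hG.connected.pos_dist_of_ne h)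
    obtain ⟨y, hy, hyk⟩ := exists_adj_dist_eq_add_one hG.connected hk
    have hins : G.neighborSet w = insert y (children G u w) := by
      ext x
      simp only [children, Set.mem_insert_iff, Set.mem_ofPred_eq, SimpleGraph.mem_neighborSet]
      constructor
      · intro hx
        rcases hG.dist_eq_dist_add_one_of_adj u hx with h' | h'
        · left
          exact (isPotential_dist hG u).eq_of_lower hx hy.symm (by exact_mod_cast h')
            (by push_cast [hk, hyk]; rfl)
        · exact .inr ⟨hx, h'⟩
      · rintro (rfl | hx)
        exacts [hy.symm, hx.1]
    have hyn : y ∉ children G u w := fun h' => by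
      have := h'.2
      omega
    rw [hins, Set.ncard_insert_of_notMem hyn (children_finite u w)] at hdeg
    omega

theorem ncard_children_pos (hT : IsSemihomogeneousTree G ε qp qm) (hqp : 1 < qp) (hqm : 1 < qm)
    (u w : V) : 0 < (children G u w).ncard := by
  classical
  rw [hT.ncard_children]
  unfold homDegree
  split_ifs <;> omega

theorem ncard_children_eq_of_dist_eq (hT : IsSemihomogeneousTree G ε qp qm) {u x y : V}
    (h : G.dist u x = G.dist u y) : (children G u x).ncard = (children G u y).ncard := by
  classical
  have hε : ε x = ε y := by rw [hT.parity_eq u, hT.parity_eq u y, h]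
  have hu : u = x ↔ u = y := by
    rw [← hT.isTree.connected.dist_eq_zero_iff, h, hT.isTree.connected.dist_eq_zero_iff]
  rw [hT.ncard_children, hT.ncard_children]
  simp only [hu, homDegree, hε]

theorem ncard_sphere_succ (hT : IsSemihomogeneousTree G ε qp qm) {u x : V} {k : ℕ}
    (h : G.dist u x = k) :
    (sphere G u (k + 1)).ncard = (sphere G u k).ncard * (children G u x).ncard := by
  have hG := hT.isTree
  have hfin := sphere_finite hG.connected u k
  rw [sphere_succ hG.connected, hfin.ncard_biUnion fun x _ => children_finite u x]
  · rw [finsum_mem_congr rfl (g := fun _ => (children G u x).ncard) fun y hy =>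
      hT.ncard_children_eq_of_dist_eq ((mem_sphere.1 hy).trans h.symm),
      finsum_mem_eq_finite_toFinset_sum _ hfin, Finset.sum_const,
      Set.ncard_eq_toFinset_card _ hfin, smul_eq_mul]
  · intro y _ z _ hyz
    refine Set.disjoint_left.2 fun w hy hz => hyz ?_
    exact (isPotential_dist hG u).eq_of_lower hy.1.symm hz.1.symm (by exact_mod_cast hy.2)
      (by exact_mod_cast hz.2)

/-- The size of a sphere in terms of its radius and the homogeneity degrees of its centre `u` and
of one of its points `w`. The induction on the radius works because the number of children of an
inner vertex `y` is `√q_y * √q_y` and the homogeneity degrees of adjacent vertices have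
product `𝔮 ^ 2`. -/
theorem ncard_sphere_mul_sqrt (hT : IsSemihomogeneousTree G ε qp qm) {u w : V} (hne : u ≠ w) :
    ((sphere G u (G.dist u w)).ncard : ℝ) *
        (√(homDegree ε qp qm u) * √(homDegree ε qp qm w)) =
      (homDegree ε qp qm u + 1) * √((qp : ℝ) * qm) ^ G.dist u w := by
  classical
  have hG := hT.isTree
  have hadj : ∀ x y, G.Adj x y →
      √(homDegree ε qp qm x : ℝ) * √(homDegree ε qp qm y) = √((qp : ℝ) * qm) := by
    intro x y h
    rw [← Real.sqrt_mul (Nat.cast_nonneg _), ← Nat.cast_mul, hT.homDegree_mul_of_adj h,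
      Nat.cast_mul]
  obtain ⟨k, hk⟩ := Nat.exists_eq_add_one.2 (hG.connected.pos_dist_of_ne hne)
  clear hne
  rw [hk]
  induction k generalizing w with
  | zero =>
    have h1 : G.Adj u w := SimpleGraph.dist_eq_one_iff_adj.1 hk
    rw [hT.ncard_sphere_succ (x := u) (by simp), sphere_zero hG.connected, hT.ncard_children,
      hadj u w h1]
    simp
  | succ k ih =>
    obtain ⟨y, hy, hyk⟩ := exists_adj_dist_eq_add_one hG.connected hk
    have hne : u ≠ y := by
      rintro rfl
      simp at hyk
    have hsq := Real.mul_self_sqrt (Nat.cast_nonneg (α := ℝ) (homDegree ε qp qm y))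
    rw [hT.ncard_sphere_succ hyk, hT.ncard_children, if_neg hne, pow_succ, Nat.cast_mul]
    linear_combination
      -(((sphere G u (k + 1)).ncard : ℝ) * √(homDegree ε qp qm u) * √(homDegree ε qp qm w)) * hsq +
      √((qp : ℝ) * qm) * ih hyk +
      ((sphere G u (k + 1)).ncard : ℝ) * √(homDegree ε qp qm u) * √(homDegree ε qp qm y) *
        hadj y w hy

end IsSemihomogeneousTree

/-! ### Existence of the equidistributed measures -/

/-- The path from `u` that leaves each vertex `x` it visits towards the chosen child `s x`. -/
def visit {u : V} (s : ∀ x, children G u x) : ℕ → V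
  | 0 => u
  | n + 1 => s (visit s n)

theorem dist_visit {u : V} (s : ∀ x, children G u x) (n : ℕ) : G.dist u (visit s n) = n := by
  induction n with
  | zero => simp [visit]
  | succ n ih => rw [visit, (s (visit s n)).2.2, ih]

/-- The ray from `u` traced by a choice of a child at each vertex. -/
def choiceRay {u : V} (s : ∀ x, children G u x) : Ray G where
  vert := visit s
  adj n := (s (visit s n)).2.1
  inj m n h := by rw [← dist_visit s m, ← dist_visit s n, h]

theorem limit_choiceRay_mem_arc (hG : G.IsTree) {u : V} (s : ∀ x, children G u x) (w : V) :
    (choiceRay s).limit ∈ arc G u w ↔ visit s (G.dist u w) = w := by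
  constructor
  · intro h
    refine (isPotential_busemann hG (choiceRay s).limit).eq_of_eq_add_dist hG.connected
      (a := u) ?_ ((mem_arc_iff hG).1 h) (dist_visit s _)
    exact (mem_arc_iff hG).1 ((choiceRay s).limit_mem_arc (G.dist u w))
  · intro h
    have := (choiceRay s).limit_mem_arc (G.dist u w)
    change _ ∈ arc G u (visit s _) at this
    rwa [h] at this

theorem uniformOn_univ_singleton {α : Type*} [Finite α] [MeasurableSpace α]
    [MeasurableSingletonClass α] (a : α) :
    ProbabilityTheory.uniformOn Set.univ ({a} : Set α) = 1 / (Nat.card α : ℝ≥0∞) := by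
  have := Fintype.ofFinite α
  rw [ProbabilityTheory.uniformOn_univ, Measure.count_singleton, Nat.card_eq_fintype_card]

section Existence

variable [G.LocallyFinite] {ε : V → ℤˣ} {qp qm : ℕ}

local instance (u x : V) : MeasurableSpace (children G u x) := ⊤

/-- The choices whose ray visits `w` form a box; its mass for uniform independent choices is a
product of reciprocal numbers of children, which is the reciprocal of the size of a sphere. -/
theorem exists_box (hT : IsSemihomogeneousTree G ε qp qm) {u w : V} {k : ℕ} (hk : G.dist u w = k) :
    ∃ (I : Finset V) (t : ∀ x, Set (children G u x)),
      {s : ∀ x, children G u x | visit s k = w} = Set.pi I t ∧ (∀ x ∈ I, G.dist u x < k) ∧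
      ∏ x ∈ I, ProbabilityTheory.uniformOn Set.univ (t x) =
        1 / ((sphere G u k).ncard : ℝ≥0∞) := by
  classical
  have hG := hT.isTree
  induction k generalizing w with
  | zero =>
    obtain rfl := hG.connected.dist_eq_zero_iff.1 hk
    refine ⟨∅, fun _ => Set.univ, ?_, by simp, by simp [sphere_zero hG.connected]⟩
    ext s
    simp [visit]
  | succ k ih =>
    obtain ⟨y, hy, hyk⟩ := exists_adj_dist_eq_add_one hG.connected hk
    obtain ⟨I, t, h1, h2, h3⟩ := ih hyk
    have hyI : y ∉ I := fun h => by
      have := h2 y h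
      omega
    have hw : w ∈ children G u y := ⟨hy, by omega⟩
    refine ⟨insert y I, Function.update t y {⟨w, hw⟩}, ?_, ?_, ?_⟩
    · ext s
      have h4 : visit s k = y ↔ s ∈ Set.pi I t := by rw [← h1]; rfl
      have h5 : (s ∈ Set.pi I (Function.update t y {⟨w, hw⟩})) ↔ s ∈ Set.pi I t := by
        refine forall₂_congr fun x hx => ?_
        rw [Function.update_of_ne (by rintro rfl; exact hyI hx)]
      rw [Finset.coe_insert, Set.insert_pi]
      simp only [Set.mem_inter_iff, h5, ← h4, Set.mem_ofPred_eq, Function.eval,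
        Function.update_self, Set.mem_preimage, Set.mem_singleton_iff, Subtype.ext_iff, visit]
      constructor
      · intro h
        have hv : visit s k = y := by
          refine (isPotential_dist hG u).eq_of_lower (x := w) ?_ hy.symm ?_ ?_
          · rw [← h]
            exact (s (visit s k)).2.1.symm
          · simp [hk, dist_visit s k]
          · simp [hk, hyk]
        exact ⟨hv ▸ h, hv⟩
      · rintro ⟨h, hv⟩
        rw [hv, h]
    · intro x hx
      rcases Finset.mem_insert.1 hx with rfl | hx
      · omega
      · exact (h2 x hx).trans (Nat.lt_succ_self k)
    · have : Finite (children G u y) := children_finite u y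
      rw [Finset.prod_insert hyI, Function.update_self, uniformOn_univ_singleton,
        Finset.prod_congr rfl (g := fun x => ProbabilityTheory.uniformOn Set.univ (t x))
          fun x hx => by rw [Function.update_of_ne (by rintro rfl; exact hyI hx)],
        h3, hT.ncard_sphere_succ hyk, Nat.card_coe_set_eq, Nat.cast_mul, mul_comm]
      simp only [one_div]
      exact (ENNReal.mul_inv (.inr (ENNReal.natCast_ne_top _))
        (.inl (ENNReal.natCast_ne_top _))).symm

theorem secondCountableTopology_boundary (hG : G.Connected) :
    SecondCountableTopology (Boundary G) := by
  have := countable_of_connected hG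
  refine ⟨⟨{S | ∃ u v, S = arc G u v}, ?_, rfl⟩⟩
  refine (Set.countable_range fun p : V × V => arc G p.1 p.2).mono ?_
  rintro _ ⟨u, v, rfl⟩
  exact ⟨(u, v), rfl⟩

theorem borel_boundary_eq (hG : G.IsTree) (u : V) (n : ℕ) :
    borel (Boundary G) =
      MeasurableSpace.generateFrom {S | ∃ w, n < G.dist u w ∧ S = arc G u w} := by
  have := secondCountableTopology_boundary hG.connected
  exact (isTopologicalBasis_arc hG u n).borel_eq_generateFrom

/-- The equidistributed measure is the law of the end of a random ray from `u` which moves from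
each vertex to a uniformly distributed child, independently for different vertices. -/
theorem IsSemihomogeneousTree.exists_isEquidistributed (hT : IsSemihomogeneousTree G ε qp qm)
    (hqp : 1 < qp) (hqm : 1 < qm) (u : V) : ∃ μ, IsEquidistributed G u μ := by
  have hG := hT.isTree
  have hfin (x : V) : Finite (children G u x) := children_finite u x
  have hne (x : V) : Nonempty (children G u x) :=
    (Set.nonempty_of_ncard_ne_zero (hT.ncard_children_pos hqp hqm u x).ne').to_subtype
  let κ (x : V) : Measure (children G u x) := ProbabilityTheory.uniformOn Set.univ
  have hκ (x : V) : IsProbabilityMeasure (κ x) :=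
    ProbabilityTheory.isProbabilityMeasure_uniformOn Set.finite_univ Set.univ_nonempty
  have hpre (w : V) : (fun s : ∀ x, children G u x => (choiceRay s).limit) ⁻¹' arc G u w =
      {s | visit s (G.dist u w) = w} := by
    ext s
    exact limit_choiceRay_mem_arc hG s w
  have hmeas : Measurable fun s : ∀ x, children G u x => (choiceRay s).limit := by
    refine (measurable_generateFrom ?_).mono le_rfl (borel_boundary_eq hG u 0).le
    rintro _ ⟨w, _, rfl⟩
    obtain ⟨I, t, h, -⟩ := exists_box hT (u := u) (w := w) rfl
    rw [hpre, h]
    exact .pi I.countable_toSet fun _ _ => trivial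
  refine ⟨(Measure.infinitePi κ).map fun s => (choiceRay s).limit, ?_, fun w => ?_⟩
  · exact Measure.isProbabilityMeasure_map hmeas.aemeasurable
  · obtain ⟨I, t, h, -, h'⟩ := exists_box hT (u := u) (w := w) rfl
    rw [Measure.map_apply hmeas (isOpen_arc u w).measurableSet, hpre, h,
      Measure.infinitePi_pi κ fun _ _ => trivial, h', G.dist_comm]
    rfl

end Existence

/-- Finite measures on the boundary are determined by the masses of small arcs. -/
theorem measure_ext_of_arc [G.LocallyFinite] (hG : G.IsTree) (u : V) (n : ℕ)
    {μ ν : Measure (Boundary G)} [IsFiniteMeasure μ]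
    (h : ∀ w, n < G.dist u w → μ (arc G u w) = ν (arc G u w)) : μ = ν := by
  have := countable_of_connected hG.connected
  refine Measure.ext_of_generateFrom_of_cover_subset (borel_boundary_eq hG u n)
    (isPiSystem_arc hG u n) subset_rfl ?_ (isTopologicalBasis_arc hG u n).sUnion_eq
    (fun s _ => measure_ne_top μ s) ?_
  · refine (Set.countable_range (arc G u)).mono ?_
    rintro _ ⟨w, _, rfl⟩
    exact ⟨w, rfl⟩
  · rintro _ ⟨w, hw, rfl⟩
    exact h w hw

theorem IsEquidistributed.unique [G.LocallyFinite] (hG : G.IsTree) {u : V}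
    {μ ν : Measure (Boundary G)} (hμ : IsEquidistributed G u μ) (hν : IsEquidistributed G u ν) :
    μ = ν := by
  have := hμ.prob
  exact measure_ext_of_arc hG u 0 fun w _ => by rw [hμ.arc_eq, hν.arc_eq]

/-! ### The arcs along a path -/

theorem dist_getVert (hG : G.IsTree) {u v : V} {p : G.Walk u v} (hp : p.IsPath) {k : ℕ}
    (hk : k ≤ p.length) :
    G.dist u (p.getVert k) = k ∧ G.dist v (p.getVert k) = p.length - k := by
  have hlen : p.length = G.dist u v := by
    obtain ⟨q, hq, hql⟩ := hG.connected.exists_path_of_dist u v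
    rw [(hG.existsUnique_path u v).unique hp hq, hql]
  have h1 := SimpleGraph.dist_le (p.take k)
  have h2 := SimpleGraph.dist_le (p.drop k)
  have h3 := hG.connected.dist_triangle (u := u) (v := p.getVert k) (w := v)
  rw [SimpleGraph.Walk.take_length] at h1
  rw [SimpleGraph.Walk.drop_length] at h2
  rw [G.dist_comm (u := v)]
  omega

theorem isOpen_arcAt (hG : G.IsTree) {u v : V} (p : G.Walk u v) (k : ℕ) :
    IsOpen (arcAt G p k) := by
  unfold arcAt
  split_ifs
  exacts [isOpen_arc _ _, (isOpen_arc _ _).sdiff (isClopen_arc hG _ _).isClosed, isOpen_arc _ _]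

/-- On the way from `u` to `v` the Busemann function of a point of `Ω_k` decreases during the
first `k` steps and increases afterwards. -/
theorem horoIndex_of_mem_arcAt (hG : G.IsTree) {u v : V} {p : G.Walk u v} (hp : p.IsPath) {k : ℕ}
    (hk : k ≤ p.length) {ω : Boundary G} (hω : ω ∈ arcAt G p k) :
    horoIndex G v u ω = 2 * (k : ℤ) - p.length := by
  have hφ := isPotential_busemann hG ω
  have hd := (dist_getVert hG hp le_rfl).1
  rw [SimpleGraph.Walk.getVert_length] at hd
  rw [horoIndex_eq hG]
  unfold arcAt at hω
  split_ifs at hω with h0 h1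
  · rw [mem_arc_iff hG, G.dist_comm, hd] at hω
    omega
  · obtain ⟨ha, hb⟩ := hω
    obtain ⟨d1, d2⟩ := dist_getVert hG hp hk
    obtain ⟨d3, d4⟩ := dist_getVert hG hp (show k + 1 ≤ p.length by omega)
    have hadj := p.adj_getVert_succ h1
    rw [mem_arc_iff hG, d1] at ha
    rw [mem_arc_iff hG, d3] at hb
    have hstep := hφ.step hadj
    have := hφ.eq_add_dist_of_last hG.connected (a := v) hadj.symm (by omega)
      (by push_cast at hb; omega)
    omega
  · rw [mem_arc_iff hG, hd] at hω
    omega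

/-! ### The density -/

theorem continuous_horoIndex (hG : G.IsTree) (x y : V) : Continuous (horoIndex G x y) := by
  have : horoIndex G x y = fun ω => busemann ω y - busemann ω x :=
    funext fun ω => horoIndex_eq hG x y ω
  rw [this]
  exact (isLocallyConstant_busemann_sub hG x y).continuous

section Density

variable {ε : V → ℤˣ} {qp qm : ℕ}

/-- The constant `c` in `dν_v / dν_u = c 𝔮 ^ h(v, u, ·)`. -/
noncomputable def densityConst (ε : V → ℤˣ) (qp qm : ℕ) (v u : V) : ℝ :=
  ((homDegree ε qp qm u + 1) * √(homDegree ε qp qm v)) /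
    ((homDegree ε qp qm v + 1) * √(homDegree ε qp qm u))

/-- The continuous function `c 𝔮 ^ h(v, u, ·)` on the boundary. -/
noncomputable def density (G : SimpleGraph V) (ε : V → ℤˣ) (qp qm : ℕ) (v u : V)
    (ω : Boundary G) : ℝ :=
  densityConst ε qp qm v u * √((qp : ℝ) * qm) ^ horoIndex G v u ω

theorem continuous_density (hG : G.IsTree) (v u : V) : Continuous (density G ε qp qm v u) :=
  (continuous_of_discreteTopology (f := fun m : ℤ =>
    densityConst ε qp qm v u * √((qp : ℝ) * qm) ^ m)).comp (continuous_horoIndex hG v u)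

theorem homDegree_pos (hqp : 1 < qp) (hqm : 1 < qm) (v : V) : 0 < homDegree ε qp qm v := by
  unfold homDegree
  split_ifs <;> omega

theorem densityConst_nonneg (v u : V) : 0 ≤ densityConst ε qp qm v u := by
  unfold densityConst
  positivity

theorem density_nonneg (v u : V) (ω : Boundary G) : 0 ≤ density G ε qp qm v u ω :=
  mul_nonneg (densityConst_nonneg v u) (zpow_nonneg (Real.sqrt_nonneg _) _)

theorem sqrt_zpow_eq_rpow {a : ℝ} (ha : 0 ≤ a) (k n : ℕ) :
    √a ^ (2 * (k : ℤ) - n) = a ^ ((k : ℝ) - (n : ℝ) / 2) := by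
  rw [← Real.rpow_intCast, Real.sqrt_eq_rpow, ← Real.rpow_mul ha]
  congr 1
  push_cast
  ring

end Density

namespace IsSemihomogeneousTree

variable [G.LocallyFinite] {ε : V → ℤˣ} {qp qm : ℕ}

theorem isEquidistributed_nu (hT : IsSemihomogeneousTree G ε qp qm) (hqp : 1 < qp)
    (hqm : 1 < qm) (u : V) : IsEquidistributed G u (nu G u) := by
  have h := hT.exists_isEquidistributed hqp hqm u
  rw [nu, dif_pos h]
  exact h.choose_spec

theorem nu_arc (hT : IsSemihomogeneousTree G ε qp qm) (hqp : 1 < qp) (hqm : 1 < qm) (u w : V) :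
    nu G u (arc G u w) = 1 / ((sphere G u (G.dist u w)).ncard : ℝ≥0∞) := by
  rw [(hT.isEquidistributed_nu hqp hqm u).arc_eq, G.dist_comm]
  rfl

theorem arc_nonempty (hT : IsSemihomogeneousTree G ε qp qm) (hqp : 1 < qp) (hqm : 1 < qm)
    (u w : V) : (arc G u w).Nonempty := by
  refine nonempty_of_measure_ne_zero (μ := nu G u) ?_
  simp [hT.nu_arc hqp hqm]

theorem isOpenPosMeasure_nu (hT : IsSemihomogeneousTree G ε qp qm) (hqp : 1 < qp)
    (hqm : 1 < qm) (u : V) : (nu G u).IsOpenPosMeasure := by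
  refine ⟨fun U hU ⟨ω, hω⟩ h => ?_⟩
  obtain ⟨_, ⟨w, _, rfl⟩, _, hw⟩ := (isTopologicalBasis_arc hT.isTree u 0).exists_subset_of_mem_open
    hω hU
  have := measure_mono_null hw h
  simp [hT.nu_arc hqp hqm] at this

/-- The ratio of the sizes of the spheres through `w` about `u` and `v`. -/
theorem ncard_sphere_div (hT : IsSemihomogeneousTree G ε qp qm) (hqp : 1 < qp) (hqm : 1 < qm)
    {u v w : V} (hu : u ≠ w) (hv : v ≠ w) :
    ((sphere G u (G.dist u w)).ncard : ℝ) / (sphere G v (G.dist v w)).ncard =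
      densityConst ε qp qm v u * √((qp : ℝ) * qm) ^ ((G.dist u w : ℤ) - G.dist v w) := by
  have hpos : ∀ x, 0 < √(homDegree ε qp qm x : ℝ) := fun x =>
    Real.sqrt_pos.2 (by exact_mod_cast homDegree_pos hqp hqm x)
  have hq : 0 < √((qp : ℝ) * qm) := Real.sqrt_pos.2 (by positivity)
  have h1 := hT.ncard_sphere_mul_sqrt hu
  have h2 := hT.ncard_sphere_mul_sqrt hv
  have e1 := eq_div_of_mul_eq (mul_pos (hpos u) (hpos w)).ne' h1
  have e2 := eq_div_of_mul_eq (mul_pos (hpos v) (hpos w)).ne' h2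
  have := hpos u
  have := hpos v
  have := hpos w
  rw [e1, e2, densityConst, zpow_sub₀ hq.ne', zpow_natCast, zpow_natCast]
  field_simp

/-- The equidistributed measures are mutually absolutely continuous, with an explicit continuous
density. -/
theorem nu_eq_withDensity (hT : IsSemihomogeneousTree G ε qp qm) (hqp : 1 < qp) (hqm : 1 < qm)
    (v u : V) :
    nu G v = (nu G u).withDensity fun ω => ENNReal.ofReal (density G ε qp qm v u ω) := by
  have hG := hT.isTree
  have := (hT.isEquidistributed_nu hqp hqm v).prob
  -- It suffices to compare the masses of arcs so small that the density is constant on them.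
  refine measure_ext_of_arc hG u (G.dist u v) fun w hw => ?_
  have hvw : v ≠ w := by rintro rfl; exact hw.ne rfl
  have huw : u ≠ w := by rintro rfl; simp at hw
  have harc := arc_eq_arc_of_dist_lt hG hw
  have hconst : ∀ ω ∈ arc G u w, ENNReal.ofReal (density G ε qp qm v u ω) =
      ENNReal.ofReal (densityConst ε qp qm v u *
        √((qp : ℝ) * qm) ^ ((G.dist u w : ℤ) - G.dist v w)) := by
    intro ω hω
    have hω' := hω
    rw [harc] at hω'
    rw [mem_arc_iff hG] at hω hω'
    rw [density, horoIndex_eq hG]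
    congr 3
    omega
  rw [withDensity_apply _ (isOpen_arc u w).measurableSet,
    setLIntegral_congr_fun (isOpen_arc u w).measurableSet hconst, setLIntegral_const,
    ← hT.ncard_sphere_div hqp hqm huw hvw, hT.nu_arc hqp hqm, harc, hT.nu_arc hqp hqm]
  have p1 := sphere_ncard_pos hG.connected u w
  have p2 := sphere_ncard_pos hG.connected v w
  rw [ENNReal.ofReal_div_of_pos (by exact_mod_cast p2), ENNReal.ofReal_natCast,
    ENNReal.ofReal_natCast, one_div, one_div, div_eq_mul_inv, mul_right_comm,
    ENNReal.mul_inv_cancel (by exact_mod_cast p1.ne') (ENNReal.natCast_ne_top _), one_mul]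

theorem nu_real_eq_of_horoIndex_eq (hT : IsSemihomogeneousTree G ε qp qm) (hqp : 1 < qp)
    (hqm : 1 < qm) {v u : V} {A : Set (Boundary G)} (hA : MeasurableSet A) {m : ℤ}
    (h : ∀ ω ∈ A, horoIndex G v u ω = m) :
    (nu G v).real A =
      densityConst ε qp qm v u * √((qp : ℝ) * qm) ^ m * (nu G u).real A := by
  have hc : ∀ ω ∈ A, ENNReal.ofReal (density G ε qp qm v u ω) =
      ENNReal.ofReal (densityConst ε qp qm v u * √((qp : ℝ) * qm) ^ m) := by
    intro ω hω
    rw [density, h ω hω]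
  rw [Measure.real, hT.nu_eq_withDensity hqp hqm v u, withDensity_apply _ hA,
    setLIntegral_congr_fun hA hc, setLIntegral_const, ENNReal.toReal_mul,
    ENNReal.toReal_ofReal (mul_nonneg (densityConst_nonneg v u)
      (zpow_nonneg (Real.sqrt_nonneg _) _))]
  rfl

theorem poissonKernel_ae_eq (hT : IsSemihomogeneousTree G ε qp qm) (hqp : 1 < qp)
    (hqm : 1 < qm) (v u : V) :
    poissonKernel G v u =ᵐ[nu G u] density G ε qp qm v u := by
  have := (hT.isEquidistributed_nu hqp hqm u).prob
  have hm : Measurable fun ω => ENNReal.ofReal (density G ε qp qm v u ω) :=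
    (continuous_density hT.isTree v u).measurable.ennreal_ofReal
  have h := Measure.rnDeriv_withDensity (nu G u) hm
  rw [← hT.nu_eq_withDensity hqp hqm] at h
  filter_upwards [h] with ω hω
  rw [poissonKernel, hω, ENNReal.toReal_ofReal (density_nonneg v u ω)]

theorem densityConst_eq_parityFactor (hT : IsSemihomogeneousTree G ε qp qm) (hqp : 1 < qp)
    {v u : V} (hu : ε u = 1) :
    densityConst ε qp qm v u = parityFactor qp qm (G.dist u v) := by
  have hp : 0 < √(qp : ℝ) := Real.sqrt_pos.2 (by positivity)
  have hv := hT.parity_eq u v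
  rw [hu, one_mul] at hv
  unfold densityConst parityFactor homDegree
  rw [if_pos hu]
  split_ifs with h1 h2 h2
  · exact div_self (by positivity)
  · rw [hv, (Nat.not_even_iff_odd.1 h2).neg_one_pow] at h1
    exact absurd h1 (by decide)
  · rw [hv, h2.neg_one_pow] at h1
    exact absurd rfl h1
  · rw [Real.sqrt_div (Nat.cast_nonneg _), mul_div_mul_comm]

theorem arcAt_nonempty (hT : IsSemihomogeneousTree G ε qp qm) (hqp : 1 < qp) (hqm : 1 < qm)
    {u v : V} {p : G.Walk u v} (hp : p.IsPath) (k : ℕ) : (arcAt G p k).Nonempty := by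
  classical
  have hG := hT.isTree
  unfold arcAt
  split_ifs with h0 h1
  · exact hT.arc_nonempty hqp hqm v u
  · -- A child of the `k`-th vertex off the path gives an arc contained in the difference.
    obtain ⟨d1, d2⟩ := dist_getVert hG hp h1.le
    have d3 := (dist_getVert hG hp (show k + 1 ≤ p.length by omega)).1
    have hadj := p.adj_getVert_succ h1
    have hcard : 1 < (children G u (p.getVert k)).ncard := by
      rw [hT.ncard_children]
      unfold homDegree
      split_ifs <;> omega
    obtain ⟨x, hx, hne⟩ := Set.exists_ne_of_one_lt_ncard hcard (p.getVert (k + 1))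
    have hdx := SimpleGraph.dist_eq_one_iff_adj.2 hx.1
    obtain ⟨ω, hω⟩ := hT.arc_nonempty hqp hqm u x
    refine ⟨ω, arc_subset_arc hG (by rw [hx.2, hdx]) hω, fun h => hne ?_⟩
    rw [mem_arc_iff hG] at hω h
    exact (isPotential_busemann hG ω).eq_of_eq_add_dist hG.connected hω h (by rw [hx.2, d1, d3])
  · exact hT.arc_nonempty hqp hqm u v

end IsSemihomogeneousTree

end TreeBoundary

theorem mainTheorem8 {V : Type*} (G : SimpleGraph V) [G.LocallyFinite]
    (ε : V → ℤˣ) (qp qm : ℕ) (hqp : 1 < qp) (hqm : 1 < qm)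
    (hT : TreeBoundary.IsSemihomogeneousTree G ε qp qm)
    (v₀ : V) (hv₀ : ε v₀ = 1) :
    -- the equidistributed measures exist and are unique
    (∀ u : V, TreeBoundary.IsEquidistributed G u (TreeBoundary.nu G u) ∧
      ∀ μ, TreeBoundary.IsEquidistributed G u μ → μ = TreeBoundary.nu G u) ∧
    -- the horospherical index does not depend on the choice of the vertex j
    (∀ (v₁ v₂ : V) (ω : TreeBoundary.Boundary G),
      (TreeBoundary.rayTo G v₁ ω ∩ TreeBoundary.rayTo G v₂ ω).Nonempty ∧
      ∀ j ∈ TreeBoundary.rayTo G v₁ ω ∩ TreeBoundary.rayTo G v₂ ω,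
        TreeBoundary.horoIndex G v₁ v₂ ω = (G.dist v₂ j : ℤ) - (G.dist v₁ j : ℤ)) ∧
    ∀ (v : V) (n : ℕ) (_ : G.dist v₀ v = n) (p : G.Walk v₀ v) (_ : p.IsPath),
      TreeBoundary.nu G v ≪ TreeBoundary.nu G v₀ ∧
      -- the arcs have positive measure, and the ratio of their measures is as claimed
      (∀ k ≤ n, 0 < (TreeBoundary.nu G v₀).real (TreeBoundary.arcAt G p k) ∧
        (TreeBoundary.nu G v).real (TreeBoundary.arcAt G p k) /
            (TreeBoundary.nu G v₀).real (TreeBoundary.arcAt G p k) =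
          if Even n then ((qp : ℝ) * (qm : ℝ)) ^ ((k : ℝ) - (n : ℝ) / 2)
          else ((qp : ℝ) + 1) / ((qm : ℝ) + 1) * √((qm : ℝ) / (qp : ℝ)) *
            ((qp : ℝ) * (qm : ℝ)) ^ ((k : ℝ) - (n : ℝ) / 2)) ∧
      -- the Radon-Nikodym derivative has exactly one continuous version K, given everywhere by
      -- the formulas
      ∃ K : TreeBoundary.Boundary G → ℝ,
        Continuous K ∧
        TreeBoundary.poissonKernel G v v₀ =ᵐ[TreeBoundary.nu G v₀] K ∧
        (∀ K' : TreeBoundary.Boundary G → ℝ, Continuous K' →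
          TreeBoundary.poissonKernel G v v₀ =ᵐ[TreeBoundary.nu G v₀] K' → K' = K) ∧
        (∀ k ≤ n, ∀ ω ∈ TreeBoundary.arcAt G p k,
          K ω = (TreeBoundary.nu G v).real (TreeBoundary.arcAt G p k) /
              (TreeBoundary.nu G v₀).real (TreeBoundary.arcAt G p k) ∧
          (K ω = if Even n then ((qp : ℝ) * (qm : ℝ)) ^ ((k : ℝ) - (n : ℝ) / 2)
            else ((qp : ℝ) + 1) / ((qm : ℝ) + 1) * √((qm : ℝ) / (qp : ℝ)) *
              ((qp : ℝ) * (qm : ℝ)) ^ ((k : ℝ) - (n : ℝ) / 2)) ∧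
          TreeBoundary.horoIndex G v v₀ ω = 2 * (k : ℤ) - (n : ℤ)) ∧
        ∀ ω, K ω = TreeBoundary.parityFactor qp qm n *
          √((qp : ℝ) * (qm : ℝ)) ^ TreeBoundary.horoIndex G v v₀ ω := by
  have hG := hT.isTree
  refine ⟨fun u => ⟨hT.isEquidistributed_nu hqp hqm u, fun μ hμ =>
    hμ.unique hG (hT.isEquidistributed_nu hqp hqm u)⟩, fun v₁ v₂ ω => ⟨?_, fun j hj => ?_⟩, ?_⟩
  · exact TreeBoundary.exists_mem_arc_inter hG v₁ v₂ ω
  · have h1 := (TreeBoundary.mem_arc_iff hG).1 hj.1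
    have h2 := (TreeBoundary.mem_arc_iff hG).1 hj.2
    rw [TreeBoundary.horoIndex_eq hG]
    omega
  intro v n hn p hp
  have := (hT.isEquidistributed_nu hqp hqm v₀).prob
  have := hT.isOpenPosMeasure_nu hqp hqm v₀
  have hlen : p.length = n := by
    rw [← hn, ← (TreeBoundary.dist_getVert hG hp le_rfl).1,
      SimpleGraph.Walk.getVert_length]
  have hc := hT.densityConst_eq_parityFactor hqp (v := v) hv₀
  rw [hn] at hc
  have hhoro : ∀ k ≤ n, ∀ ω ∈ TreeBoundary.arcAt G p k,
      TreeBoundary.horoIndex G v v₀ ω = 2 * (k : ℤ) - (n : ℤ) := by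
    intro k hk ω hω
    rw [TreeBoundary.horoIndex_of_mem_arcAt hG hp (hk.trans_eq hlen.symm) hω,
      hlen]
  have hpos : ∀ k, 0 < (TreeBoundary.nu G v₀).real (TreeBoundary.arcAt G p k) := fun k =>
    ENNReal.toReal_pos ((TreeBoundary.isOpen_arcAt hG p k).measure_pos _
      (hT.arcAt_nonempty hqp hqm hp k)).ne' (measure_ne_top _ _)
  have hform : ∀ k : ℕ, TreeBoundary.parityFactor qp qm n *
      √((qp : ℝ) * (qm : ℝ)) ^ (2 * (k : ℤ) - (n : ℤ)) =
      if Even n then ((qp : ℝ) * (qm : ℝ)) ^ ((k : ℝ) - (n : ℝ) / 2)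
      else ((qp : ℝ) + 1) / ((qm : ℝ) + 1) * √((qm : ℝ) / (qp : ℝ)) *
        ((qp : ℝ) * (qm : ℝ)) ^ ((k : ℝ) - (n : ℝ) / 2) := by
    intro k
    rw [TreeBoundary.sqrt_zpow_eq_rpow (by positivity), TreeBoundary.parityFactor, ite_mul, one_mul]
  have hratio : ∀ k ≤ n, (TreeBoundary.nu G v).real (TreeBoundary.arcAt G p k) /
      (TreeBoundary.nu G v₀).real (TreeBoundary.arcAt G p k) =
      TreeBoundary.parityFactor qp qm n * √((qp : ℝ) * (qm : ℝ)) ^ (2 * (k : ℤ) - (n : ℤ)) := by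
    intro k hk
    rw [hT.nu_real_eq_of_horoIndex_eq hqp hqm
      (TreeBoundary.isOpen_arcAt hG p k).measurableSet (hhoro k hk), hc,
      mul_div_cancel_right₀ _ (hpos k).ne']
  have hK : ∀ ω, TreeBoundary.density G ε qp qm v v₀ ω =
      TreeBoundary.parityFactor qp qm n *
        √((qp : ℝ) * (qm : ℝ)) ^ TreeBoundary.horoIndex G v v₀ ω := by
    intro ω
    rw [TreeBoundary.density, hc]
  have hcont := TreeBoundary.continuous_density (ε := ε) (qp := qp)
    (qm := qm) hG v v₀
  have hae := hT.poissonKernel_ae_eq hqp hqm v v₀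
  refine ⟨?_, fun k hk => ⟨hpos k, (hratio k hk).trans (hform k)⟩,
    TreeBoundary.density G ε qp qm v v₀, hcont, hae,
    fun K' hK' h => ?_, fun k hk ω hω => ?_, hK⟩
  · rw [hT.nu_eq_withDensity hqp hqm v v₀]
    exact withDensity_absolutelyContinuous _ _
  · exact (Continuous.ae_eq_iff_eq _ hK' hcont).1 (h.symm.trans hae)
  · have h := hK ω
    rw [hhoro k hk ω hω] at h
    exact ⟨h.trans (hratio k hk).symm, h.trans (hform k), hhoro k hk ω hω⟩
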